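/- Let $d,\ell,m\ge 0$ be integers and let $h_1,\dots,h_\ell\in\mathbb{R}^d$ be vectors such that the subgroup $h_1\mathbb{Z}+\cdots+h_\ell\mathbb{Z}$ is dense in $\mathbb{R}^d$. For $h\in\mathbb{R}^d$ let $\Delta_h$ denote the forward difference operator: $(\Delta_h f)(x)=f(x+h)-f(x)$ for functions $f:\mathbb{R}^d\to\mathbb{C}$, and $(\Delta_h T)(\varphi)=T(\varphi(\cdot-h))-T(\varphi)$ for complex valued distributions $T$ on $\mathbb{R}^d$ and test functions $\varphi\in C_c^\infty(\mathbb{R}^d)$; $\Delta_h^m$ is its $m$-th iterate. (a) If $f:\mathbb{R}^d\to\mathbb{C}$ is continuous and $\Delta_{h_k}^m f=0$ for $k=1,\dots,\ell$, then there are $N\in\mathbb{N}$ and complex numbers $a_\alpha$ such that $f(x)=\sum_{|\alpha|<N}a_\alpha x^\alpha$ for all $x\in\mathbb{R}^d$. If $d=1$, one can take $N=m$, i.e. $f$ is a polynomial of degree $\le m-1$ (the zero polynomial when $m=0$). (b) If $T$ is a complex valued distribution on $\mathbb{R}^d$ and $\Delta_{h_k}^m T=0$ for $k=1,\dots,\ell$,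 then $T$ is (the regular distribution given by) an ordinary polynomial: there are $N\in\mathbb{N}$ and complex numbers $a_\alpha$ such that $T(\varphi)=\int_{\mathbb{R}^d}\varphi(x)\sum_{|\alpha|<N}a_\alpha x^\alpha\,dx$ for every test function $\varphi$. If $d=1$, one can take $N=m$. -/

import Mathlib

open TopologicalSpace Set
open scoped Distributions ContDiff

noncomputable section

variable {E : Type*} [NormedAddCommGroup E] [NormedSpace ℝ E]

/-- The test function `x ↦ φ (x - h)`. -/
def testTranslate (h : E) (φ : 𝓓((⊤ : Opens E), ℝ)) : 𝓓((⊤ : Opens E), ℝ) where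
  toFun x := φ (x - h)
  contDiff' := φ.contDiff.comp (contDiff_id.sub contDiff_const)
  hasCompactSupport' := φ.hasCompactSupport.comp_homeomorph (Homeomorph.subRight h)
  tsupport_subset' := fun _ _ => trivial

/-- The compact set `K + h`. -/
def compactTranslate (h : E) (K : Compacts E) : Compacts E :=
  ⟨(fun x => x + h) '' (K : Set E), K.isCompact.image (continuous_id.add continuous_const)⟩

/-- Translation as a continuous linear map from the smooth functions supported in `K` to the
smooth functions supported in `K + h`. -/
def supportedTranslateCLM (h : E) (K : Compacts E) :
    𝓓^{⊤}_{K}(E, ℝ) →L[ℝ] 𝓓^{⊤}_{compactTranslate h K}(E, ℝ) :=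
  ContDiffMapSupportedIn.mkCLM ℝ (fun φ x => φ (x - h))
    (fun _ _ _ => rfl) (fun _ _ _ => rfl)
    (fun φ => φ.contDiff.comp (contDiff_id.sub contDiff_const))
    (fun φ x hx => φ.zero_on_compl fun hK => hx ⟨x - h, hK, sub_add_cancel x h⟩)
    (fun i hi => ⟨{i}, 1, zero_le_one, fun φ x _ => by
      rw [iteratedFDeriv_comp_sub, one_mul, Finset.sup_singleton]
      exact ContDiffMapSupportedIn.norm_iteratedFDeriv_apply_le_seminorm ℝ hi⟩)

/-- Translation `φ ↦ φ (· - h)` as a continuous linear map on the space of test functions. -/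
def testTranslateCLM (h : E) : 𝓓((⊤ : Opens E), ℝ) →L[ℝ] 𝓓((⊤ : Opens E), ℝ) :=
  TestFunction.limitCLM ℝ (testTranslate h)
    (fun K _ => TestFunction.ofSupportedInCLM ℝ (fun _ _ => trivial) ∘L supportedTranslateCLM h K)
    (fun _ _ _ => rfl)

/-- The translate `τ_h T` of a complex valued distribution `T`, which extends
`(τ_h f) (x) = f (x + h)`: it is given by `(τ_h T) (φ) = T (φ (· - h))`. -/
def distTranslate (h : E) (T : 𝓓'((⊤ : Opens E), ℂ)) : 𝓓'((⊤ : Opens E), ℂ) :=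
  (testTranslateCLM h).precompCompactConvergenceCLM ℂ T

/-- The forward difference `Δ_h T = τ_h T - T` of a complex valued distribution. -/
def distFwdDiff (h : E) (T : 𝓓'((⊤ : Opens E), ℂ)) : 𝓓'((⊤ : Opens E), ℂ) :=
  distTranslate h T - T

theorem testTranslateCLM_apply (h : E) (φ : 𝓓((⊤ : Opens E), ℝ)) (x : E) :
    testTranslateCLM h φ x = φ (x - h) := rfl

theorem distFwdDiff_apply (h : E) (T : 𝓓'((⊤ : Opens E), ℂ)) (φ : 𝓓((⊤ : Opens E), ℝ)) :
    distFwdDiff h T φ = T (testTranslateCLM h φ) - T φ := rfl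

/-- The function on `ℝ^d` given by a complex polynomial in `d` variables. -/
def polyFun {d : ℕ} (p : MvPolynomial (Fin d) ℂ) (x : EuclideanSpace ℝ (Fin d)) : ℂ :=
  MvPolynomial.eval (fun i => (x i : ℂ)) p

end

/-! In the group algebra of `ℝ^d` acting by translation, `Δ_h` is the action of `[h] - 1`. For `g`
in the subgroup generated by the `h_k`, `[g] - 1` lies in the ideal generated by the `[h_k] - 1`.
That ideal is finitely generated and lies in the radical of the ideal generated by the `([h_k] -
1)^m`, so some power `([g] - 1)^M` lies in the latter. Hence `Δ_g^M f = 0` on the whole subgroup,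
and by density and continuity for every `g ∈ ℝ^d`.

Restricted to a line, `f` is then a polynomial of degree `< M`: Newton's formula gives this on every
grid, grids sharing infinitely many points carry the same polynomial, and continuity does the rest.
Lagrange interpolation in one coordinate at a time assembles the lines into a polynomial in `d`
variables, of degree `< M` in each.

For a distribution `T`, each function `x ↦ T(φ(· - x))` is continuous and inherits the difference
equations, so it is a polynomial with the same degree bound. Taking an approximate identity for `φ`,
`T` is a pointwise limit of functionals of integration against such polynomials. These form a
finite-dimensional, hence closed, space, so `T` belongs to it
(`mem_map_polyFunctional_of_forall_mem_boundedPolyFun`). -/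

open scoped Pointwise

/-! ### Iterated differences along a subgroup -/

section FwdDiff

variable {V G : Type*} [AddCommGroup V] [AddCommGroup G]

/-- The representation of `V` on functions by translation, extended to the group algebra. -/
noncomputable def translationHom (V G : Type*) [AddCommGroup V] [AddCommGroup G] :
    AddMonoidAlgebra ℤ V →ₐ[ℤ] Module.End ℤ (V → G) :=
  AddMonoidAlgebra.lift ℤ (Module.End ℤ (V → G)) V
    { toFun := fun g => LinearMap.funLeft ℤ G (fun x => x + g.toAdd)
      map_one' := by ext f x; simp [LinearMap.funLeft_apply]
      map_mul' := fun a b => by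
        ext f x
        simp [LinearMap.funLeft_apply, add_assoc] }

theorem translationHom_single_sub_one (g : V) (f : V → G) :
    translationHom V G (AddMonoidAlgebra.single g 1 - 1) f = fwdDiff g f := by
  ext x
  simp [translationHom, fwdDiff, LinearMap.funLeft_apply]

theorem translationHom_single_sub_one_pow (g : V) (n : ℕ) (f : V → G) :
    translationHom V G ((AddMonoidAlgebra.single g 1 - 1) ^ n) f = (fwdDiff g)^[n] f := by
  rw [map_pow, Module.End.pow_apply]
  congr 2
  funext f
  exact translationHom_single_sub_one g f

/-- The augmentation element of a member of the subgroup generated by the `h k` lies in the ideal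
generated by the augmentation elements of the `h k`. -/
theorem single_sub_one_mem_span {ι : Type*} (h : ι → V) {g : V}
    (hg : g ∈ AddSubgroup.closure (range h)) :
    (AddMonoidAlgebra.single g 1 - 1 : AddMonoidAlgebra ℤ V) ∈
      Ideal.span (range fun k => (AddMonoidAlgebra.single (h k) 1 - 1 : AddMonoidAlgebra ℤ V)) := by
  induction hg using AddSubgroup.closure_induction with
  | mem x hx =>
    obtain ⟨k, rfl⟩ := hx
    exact Ideal.subset_span ⟨k, rfl⟩
  | zero => simp [AddMonoidAlgebra.one_def]
  | add x y _ _ hx hy =>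
    have : (AddMonoidAlgebra.single (x + y) 1 - 1 : AddMonoidAlgebra ℤ V) =
        AddMonoidAlgebra.single y 1 * (AddMonoidAlgebra.single x 1 - 1) +
          (AddMonoidAlgebra.single y 1 - 1) := by
      rw [mul_sub, AddMonoidAlgebra.single_mul_single, add_comm y x]
      simp
    rw [this]
    exact Ideal.add_mem _ (Ideal.mul_mem_left _ _ hx) hy
  | neg x _ hx =>
    have : (AddMonoidAlgebra.single (-x) 1 - 1 : AddMonoidAlgebra ℤ V) =
        (-AddMonoidAlgebra.single (-x) 1) * (AddMonoidAlgebra.single x 1 - 1) := by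
      rw [mul_sub, neg_mul, AddMonoidAlgebra.single_mul_single]
      simp [AddMonoidAlgebra.one_def]
      abel
    rw [this]
    exact Ideal.mul_mem_left _ _ hx

/-- The exponent comes from an inclusion of ideals, so it depends only on `h` and `m`. This
uniformity in `f` is what later gives one degree bound for all regularizations of a distribution. -/
theorem exists_fwdDiff_iterate_eq_zero {ι : Type*} [Finite ι] (h : ι → V) (m : ℕ) :
    ∃ M : ℕ, ∀ f : V → G, (∀ k, (fwdDiff (h k))^[m] f = 0) →
      ∀ g ∈ AddSubgroup.closure (range h), (fwdDiff g)^[M] f = 0 := by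
  let a : ι → AddMonoidAlgebra ℤ V := fun k => AddMonoidAlgebra.single (h k) 1 - 1
  let I : Ideal (AddMonoidAlgebra ℤ V) := Ideal.span (range fun k => a k ^ m)
  have hle : Ideal.span (range a) ≤ I.radical := by
    rw [Ideal.span_le]
    rintro _ ⟨k, rfl⟩
    exact ⟨m, Ideal.subset_span ⟨k, rfl⟩⟩
  obtain ⟨M, hM⟩ := Ideal.exists_pow_le_of_le_radical_of_fg hle
    (Submodule.fg_span (Set.finite_range a))
  refine ⟨M, fun f hf g hg => ?_⟩
  rw [← translationHom_single_sub_one_pow]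
  have hmem : (AddMonoidAlgebra.single g 1 - 1 : AddMonoidAlgebra ℤ V) ^ M ∈ I :=
    hM (Ideal.pow_mem_pow (single_sub_one_mem_span h hg) M)
  -- The elements that annihilate `f` form an ideal, so the generators suffice.
  generalize (AddMonoidAlgebra.single g 1 - 1 : AddMonoidAlgebra ℤ V) ^ M = b at hmem ⊢
  induction hmem using Submodule.span_induction with
  | mem x hx =>
    obtain ⟨k, rfl⟩ := hx
    simpa only [a, translationHom_single_sub_one_pow] using hf k
  | zero => simp
  | add x y _ _ hx hy => rw [map_add, LinearMap.add_apply, hx, hy, add_zero]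
  | smul r x _ hx => rw [smul_eq_mul, map_mul, Module.End.mul_apply, hx, map_zero]

theorem fwdDiff_iterate_eq_zero_of_dense {V G : Type*} [AddCommGroup V] [TopologicalSpace V]
    [IsTopologicalAddGroup V] [AddCommGroup G] [TopologicalSpace G] [IsTopologicalAddGroup G]
    [T2Space G] {f : V → G} (hf : Continuous f) {M : ℕ} {s : Set V} (hs : Dense s)
    (h : ∀ g ∈ s, (fwdDiff g)^[M] f = 0) (g : V) : (fwdDiff g)^[M] f = 0 := by
  ext x
  have hc : Continuous fun g => (fwdDiff g)^[M] f x := by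
    simp only [fwdDiff_iter_eq_sum_shift]
    fun_prop
  exact congr_fun (hc.ext_on hs continuous_const fun g hg => congr_fun (h g hg) x) g

theorem fwdDiff_iterate_comp_line {V G : Type*} [AddCommGroup V] [Module ℝ V] [AddCommGroup G]
    (f : V → G) (x v : V) (c : ℝ) (n : ℕ) (t : ℝ) :
    (fwdDiff c)^[n] (fun t : ℝ => f (x + t • v)) t = (fwdDiff (c • v))^[n] f (x + t • v) := by
  simp only [fwdDiff_iter_eq_sum_shift, add_smul, smul_assoc, add_assoc]

end FwdDiff

/-! ### One variable -/

section OneVariable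

open Polynomial

/-- Newton's forward difference formula, truncated at order `m`. -/
theorem exists_polynomial_eval_natCast {u : ℕ → ℂ} {m : ℕ} (h : (fwdDiff 1)^[m] u = 0) :
    ∃ r : ℂ[X], r.degree < m ∧ ∀ n : ℕ, u n = r.eval (n : ℂ) := by
  have hz : ∀ k, m ≤ k → (fwdDiff 1)^[k] u 0 = 0 := by
    intro k hk
    obtain ⟨j, rfl⟩ := Nat.exists_eq_add_of_le hk
    rw [add_comm, Function.iterate_add_apply, h]
    simp [fwdDiff_iter_eq_sum_shift]
  refine ⟨∑ k ∈ Finset.range m,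
    C ((fwdDiff 1)^[k] u 0 / (k.factorial : ℂ)) * descPochhammer ℂ k, ?_, fun n => ?_⟩
  · refine lt_of_le_of_lt (degree_sum_le _ _) ?_
    rw [Finset.sup_lt_iff (by exact_mod_cast WithBot.bot_lt_coe m)]
    intro k hk
    refine lt_of_le_of_lt ((degree_mul_le _ _).trans (add_le_of_nonpos_left degree_C_le)) ?_
    rw [degree_eq_natDegree (monic_descPochhammer ℂ k).ne_zero, descPochhammer_natDegree]
    exact_mod_cast Finset.mem_range.1 hk
  · have key := shift_eq_sum_fwdDiff_iter (1 : ℕ) u n 0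
    simp only [zero_add, smul_eq_mul, mul_one] at key
    rw [key, eval_finsetSum]
    have e : ∀ k, (C ((fwdDiff 1)^[k] u 0 / (k.factorial : ℂ)) * descPochhammer ℂ k).eval (n : ℂ) =
        n.choose k • (fwdDiff 1)^[k] u 0 := by
      intro k
      have hk : (k.factorial : ℂ) ≠ 0 := by exact_mod_cast k.factorial_ne_zero
      rw [eval_mul, eval_C, descPochhammer_eval_eq_descFactorial,
        Nat.descFactorial_eq_factorial_mul_choose, nsmul_eq_mul]
      push_cast
      field_simp
    rw [Finset.sum_congr rfl fun k _ => e k]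
    -- Both sums extend to a common range: `n.choose k` vanishes for `k > n`, the differences at `0`
    -- for `k ≥ m`.
    trans ∑ k ∈ Finset.range (max m (n + 1)), n.choose k • (fwdDiff 1)^[k] u 0
    · refine Finset.sum_subset (Finset.range_mono (le_max_right _ _)) fun k _ hk => ?_
      rw [Nat.choose_eq_zero_of_lt (by simpa using hk), zero_smul]
    · symm
      refine Finset.sum_subset (Finset.range_mono (le_max_left _ _)) fun k _ hk => ?_
      rw [hz k (by simpa using hk), smul_zero]

theorem exists_polynomial_eval_add_mul {u : ℝ → ℂ} {m : ℕ} {c : ℝ} (hc : c ≠ 0)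
    (h : (fwdDiff c)^[m] u = 0) (y : ℝ) :
    ∃ r : ℂ[X], r.degree < m ∧ ∀ n : ℕ, u (y + n * c) = r.eval ((y + n * c : ℝ) : ℂ) := by
  obtain ⟨r, hr, hu⟩ := exists_polynomial_eval_natCast (u := fun n : ℕ => u (y + n * c)) (m := m) (by
    ext n
    have := congr_fun h (y + n * c)
    rw [fwdDiff_iter_eq_sum_shift] at this ⊢
    rw [Pi.zero_apply] at this ⊢
    rw [← this]
    refine Finset.sum_congr rfl fun k _ => ?_
    congr 2
    simp
    ring)
  -- This is the polynomial `z ↦ r ((z - y) / c)`.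
  refine ⟨taylor (-(y : ℂ)) (r.comp (C (c : ℂ)⁻¹ * X)), ?_, fun n => ?_⟩
  · rw [degree_taylor, degree_lt_iff_coeff_zero]
    intro k hk
    rw [comp_C_mul_X_coeff, (degree_lt_iff_coeff_zero _ _).1 hr k hk, zero_mul]
  · have hc' : (c : ℂ) ≠ 0 := by exact_mod_cast hc
    rw [hu n, taylor_eval, eval_comp]
    congr 1
    simp
    field_simp

theorem exists_polynomial_of_fwdDiff_iterate {u : ℝ → ℂ} (hu : Continuous u) {M : ℕ}
    (h : ∀ t, (fwdDiff t)^[M] u = 0) :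
    ∃ q : ℂ[X], q.degree < M ∧ ∀ t : ℝ, u t = q.eval (t : ℂ) := by
  obtain ⟨q, hq, hqu⟩ := exists_polynomial_eval_add_mul one_ne_zero (h 1) 0
  have grid : ∀ a b n : ℕ, b ≠ 0 →
      u (-a + n * (b : ℝ)⁻¹) = q.eval ((-a + n * (b : ℝ)⁻¹ : ℝ) : ℂ) := by
    intro a b n hb
    have hb' : (b : ℝ) ≠ 0 := by exact_mod_cast hb
    obtain ⟨r, -, hru⟩ := exists_polynomial_eval_add_mul (inv_ne_zero hb') (h (b : ℝ)⁻¹) (-a)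
    -- The grid `-a + ℕ / b` contains every natural number `k`, at index `(k + a) * b`, and `q`
    -- interpolates `u` at all of these.
    have : r = q := by
      refine eq_of_infinite_eval_eq _ _
        ((Set.infinite_range_of_injective (Nat.cast_injective (R := ℂ))).mono ?_)
      rintro _ ⟨k, rfl⟩
      have h1 := hru ((k + a) * b)
      have h2 := hqu k
      have e : (-a + ((k + a) * b : ℕ) * (b : ℝ)⁻¹ : ℝ) = k := by
        push_cast
        field_simp
        ring
      rw [e] at h1
      rw [zero_add, mul_one] at h2
      rw [Set.mem_ofPred_eq]
      push_cast at h1 h2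
      rw [← h1, ← h2]
    rw [hru n, this]
  refine ⟨q, hq, fun t => ?_⟩
  -- The choice makes `t + a ≥ 0`, so that the natural floor of `(t + a) * b`, divided by `b`, tends
  -- to `t + a`.
  obtain ⟨a, ha⟩ := exists_nat_ge (-t)
  have lim : Filter.Tendsto (fun b : ℕ => (-a + (⌊(t + a) * b⌋₊ : ℝ) * (b : ℝ)⁻¹)) Filter.atTop
      (nhds t) := by
    have := ((tendsto_nat_floor_mul_div_atTop (R := ℝ) (a := t + a) (by linarith)).comp
      tendsto_natCast_atTop_atTop).const_add (-(a : ℝ))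
    simpa [Function.comp_def, div_eq_mul_inv] using this
  have hq' : Continuous fun t : ℝ => q.eval (t : ℂ) := by fun_prop
  refine tendsto_nhds_unique ((hu.tendsto t).comp lim) (((hq'.tendsto t).comp lim).congr' ?_)
  filter_upwards [Filter.eventually_ne_atTop 0] with b hb
  exact (grid a b _ hb).symm

/-- A single nonzero step already bounds the degree: Newton's polynomial on the grid `ℕ c` agrees
with `q` at infinitely many points. -/
theorem degree_lt_of_fwdDiff_iterate {q : ℂ[X]} {c : ℝ} (hc : c ≠ 0) {m : ℕ}
    (h : (fwdDiff c)^[m] (fun t : ℝ => q.eval (t : ℂ)) = 0) : q.degree < m := by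
  obtain ⟨r, hr, hqr⟩ := exists_polynomial_eval_add_mul hc h 0
  have : q = r := by
    refine eq_of_infinite_eval_eq _ _ ((Set.infinite_range_of_injective
      (f := fun n : ℕ => ((0 + n * c : ℝ) : ℂ)) fun a b hab => ?_).mono ?_)
    · simpa [hc] using hab
    · rintro _ ⟨n, rfl⟩
      exact hqr n
  rwa [this]

end OneVariable

/-! ### Several variables -/

section SeveralVariables

open Polynomial

variable {d : ℕ}

/-- `polyFun` as a linear map. -/
noncomputable def polyFunₗ (d : ℕ) :
    MvPolynomial (Fin d) ℂ →ₗ[ℂ] (EuclideanSpace ℝ (Fin d) → ℂ) where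
  toFun p := polyFun p
  map_add' p q := by ext x; simp [polyFun]
  map_smul' c p := by ext x; simp [polyFun]

/-- The exponents that are supported in `s` and less than `N` at each index in `s`. -/
def boundedExponents (N : ℕ) (s : Finset (Fin d)) : Set (Fin d →₀ ℕ) :=
  {α | ∀ i, (i ∈ s → α i < N) ∧ (i ∉ s → α i = 0)}

/-- The polynomial functions in the variables `x i`, `i ∈ s`, of degree `< N` in each of them. -/
noncomputable def boundedPolyFun (N : ℕ) (s : Finset (Fin d)) :
    Submodule ℂ (EuclideanSpace ℝ (Fin d) → ℂ) :=
  (MvPolynomial.restrictSupport ℂ (boundedExponents N s)).map (polyFunₗ d)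

theorem finite_boundedExponents (N : ℕ) (s : Finset (Fin d)) : (boundedExponents N s).Finite := by
  refine (Set.finite_Iic (Finsupp.equivFunOnFinite.symm fun _ => N)).subset fun α hα i => ?_
  by_cases hi : i ∈ s
  · exact ((hα i).1 hi).le
  · simp [(hα i).2 hi]

theorem coord_pow_mul_mem_boundedPolyFun {N r : ℕ} {s : Finset (Fin d)} {i : Fin d} (hi : i ∉ s)
    (hr : r < N) {F : EuclideanSpace ℝ (Fin d) → ℂ} (hF : F ∈ boundedPolyFun N s) :
    (fun x => (x i : ℂ) ^ r * F x) ∈ boundedPolyFun N (insert i s) := by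
  classical
  obtain ⟨p, hp, rfl⟩ := hF
  refine ⟨MvPolynomial.monomial (Finsupp.single i r) 1 * p, ?_, ?_⟩
  · intro α hα
    obtain ⟨β, hβ, γ, hγ, rfl⟩ := Finset.mem_add.1 (MvPolynomial.support_mul _ _ hα)
    obtain rfl := Finset.mem_singleton.1 (MvPolynomial.support_monomial_subset hβ)
    have hγ' := hp hγ
    intro j
    rcases eq_or_ne j i with rfl | hj
    · simp [(hγ' j).2 hi, hr]
    · simpa [hj, Finsupp.single_apply, hj.symm] using hγ' j
  · ext x
    simp [polyFunₗ, polyFun, MvPolynomial.eval_monomial]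

/-- Induction on the variables that `f` depends on. Interpolation in `x i` at the nodes `0, …, N -
1` expresses `f` through its slices `x i = j`, which depend on one variable fewer. -/
theorem mem_boundedPolyFun_of_forall_line {N : ℕ} (s : Finset (Fin d)) :
    ∀ f : EuclideanSpace ℝ (Fin d) → ℂ,
      (∀ i x, ∃ q : ℂ[X], q.degree < N ∧
        ∀ t : ℝ, f (x + t • EuclideanSpace.single i 1) = q.eval (t : ℂ)) →
      (∀ x y, (∀ i ∈ s, x i = y i) → f x = f y) → f ∈ boundedPolyFun N s := by
  classical
  induction s using Finset.induction_on with
  | empty =>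
    intro f _ hdep
    refine ⟨MvPolynomial.C (f 0), ?_, ?_⟩
    · intro α hα
      have : α = 0 := by
        simpa using MvPolynomial.support_monomial_subset hα
      simp [this, boundedExponents]
    · ext x
      simpa [polyFunₗ, polyFun] using hdep 0 x (by simp)
  | insert i s hi ih =>
    intro f hf hdep
    let f' : ℕ → EuclideanSpace ℝ (Fin d) → ℂ := fun j x =>
      f (x + ((j : ℝ) - x i) • EuclideanSpace.single i 1)
    have hf' : ∀ j < N, f' j ∈ boundedPolyFun N s := by
      intro j hj
      refine ih _ (fun k x => ?_) fun x y hxy => hdep _ _ fun k hk => ?_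
      · rcases eq_or_ne k i with rfl | hk
        · refine ⟨C (f' j x), lt_of_le_of_lt degree_C_le (by exact_mod_cast by omega), fun t => ?_⟩
          rw [eval_C]
          simp only [f']
          congr 1
          ext l
          by_cases hl : l = k <;> simp [hl]
        · obtain ⟨q, hq, hqf⟩ := hf k (x + ((j : ℝ) - x i) • EuclideanSpace.single i 1)
          refine ⟨q, hq, fun t => ?_⟩
          rw [← hqf t]
          simp only [f']
          congr 1
          ext l
          simp [hk.symm]
          ring
      · rcases eq_or_ne k i with rfl | hki
        · simp
        · simpa [hki] using hxy k (Finset.mem_of_mem_insert_of_ne hk hki)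
    let ℓ : ℕ → ℂ[X] := Lagrange.basis (Finset.range N) (fun j : ℕ => (j : ℂ))
    have inj : Set.InjOn (fun j : ℕ => (j : ℂ)) (Finset.range N) := Nat.cast_injective.injOn
    have hfe : f = ∑ j ∈ Finset.range N, ∑ r ∈ Finset.range N,
        (ℓ j).coeff r • fun x : EuclideanSpace ℝ (Fin d) => (x i : ℂ) ^ r * f' j x := by
      ext x
      -- With coordinate `i` of the base point set to zero, the parameter on the line is that
      -- coordinate itself.
      obtain ⟨q, hq, hqf⟩ := hf i (x - x i • EuclideanSpace.single i 1)
      have h1 : f x = q.eval (x i : ℂ) := by rw [← hqf]; simp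
      have h2 : ∀ j : ℕ, q.eval (j : ℂ) = f' j x := by
        intro j
        have := hqf j
        push_cast at this
        rw [← this]
        simp only [f']
        congr 1
        module
      have h3 := Lagrange.eq_interpolate inj (f := q) (by simpa using hq)
      rw [h1, h3, Lagrange.interpolate_apply, eval_finsetSum, Finset.sum_apply]
      refine Finset.sum_congr rfl fun j hj => ?_
      have hdeg : (ℓ j).natDegree < N := by
        have := Lagrange.degree_basis inj hj
        rw [Finset.card_range] at this
        have hN := Finset.mem_range.1 hj
        have : (ℓ j).natDegree = N - 1 := natDegree_eq_of_degree_eq_some this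
        omega
      rw [eval_mul, eval_C, h2, Finset.sum_apply]
      change _ * (ℓ j).eval _ = _
      rw [eval_eq_sum_range' hdeg, Finset.mul_sum]
      refine Finset.sum_congr rfl fun r _ => ?_
      simp
      ring
    rw [hfe]
    exact Submodule.sum_mem _ fun j hj => Submodule.sum_mem _ fun r hr => Submodule.smul_mem _ _
      (coord_pow_mul_mem_boundedPolyFun hi (Finset.mem_range.1 hr) (hf' j (Finset.mem_range.1 hj)))

/-- The exponent `M` may exceed `m`. For `d = 1` density forces some `h k ≠ 0`, and its equation
lowers the degree bound from `M` to `m`. -/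
theorem exists_forall_mem_boundedPolyFun {ι : Type*} [Finite ι] (m : ℕ)
    (h : ι → EuclideanSpace ℝ (Fin d))
    (hdense : Dense (AddSubgroup.closure (range h) : Set (EuclideanSpace ℝ (Fin d)))) :
    ∃ N : ℕ, (d = 1 → N = m) ∧ ∀ f : EuclideanSpace ℝ (Fin d) → ℂ, Continuous f →
      (∀ k, (fwdDiff (h k))^[m] f = 0) → f ∈ boundedPolyFun N Finset.univ := by
  obtain ⟨M, hM⟩ := exists_fwdDiff_iterate_eq_zero (G := ℂ) h m
  have line : ∀ f : EuclideanSpace ℝ (Fin d) → ℂ, Continuous f →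
      (∀ k, (fwdDiff (h k))^[m] f = 0) → ∀ i x, ∃ q : ℂ[X], q.degree < M ∧
        ∀ t : ℝ, f (x + t • EuclideanSpace.single i 1) = q.eval (t : ℂ) := by
    intro f hf hm i x
    refine exists_polynomial_of_fwdDiff_iterate
      (u := fun t : ℝ => f (x + t • EuclideanSpace.single i 1)) (by fun_prop) fun t => ?_
    ext s
    rw [fwdDiff_iterate_comp_line,
      fwdDiff_iterate_eq_zero_of_dense hf hdense (hM f hm)]
    rfl
  have univ_dep : ∀ (f : EuclideanSpace ℝ (Fin d) → ℂ) x y,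
      (∀ i ∈ Finset.univ, x i = y i) → f x = f y := fun f x y hxy => by
    congr 1
    ext i
    exact hxy i (Finset.mem_univ i)
  by_cases hd : d = 1
  · subst hd
    refine ⟨m, fun _ => rfl, fun f hf hm =>
      mem_boundedPolyFun_of_forall_line _ f (fun i x => ?_) (univ_dep f)⟩
    obtain ⟨q, -, hq⟩ := line f hf hm i x
    refine ⟨q, ?_, hq⟩
    obtain ⟨k, hk⟩ : ∃ k, h k ≠ 0 := by
      by_contra! hz
      have : AddSubgroup.closure (range h) = ⊥ := by
        rw [AddSubgroup.closure_eq_bot_iff]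
        rintro _ ⟨k, rfl⟩
        exact hz k
      rw [this, AddSubgroup.coe_bot, dense_iff_closure_eq, closure_singleton] at hdense
      have : (EuclideanSpace.single 0 1 : EuclideanSpace ℝ (Fin 1)) ∈ ({0} : Set _) :=
        hdense ▸ mem_univ _
      simp at this
    have hki : h k = (h k i) • EuclideanSpace.single i 1 := by
      ext j
      simp [Subsingleton.elim j i]
    refine degree_lt_of_fwdDiff_iterate (c := h k i) (fun h0 => hk ?_) ?_
    · rw [hki, h0, zero_smul]
    · rw [← funext hq]
      ext s
      rw [fwdDiff_iterate_comp_line, ← hki, hm k]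
      rfl
  · exact ⟨M, fun h1 => absurd h1 hd, fun f hf hm =>
      mem_boundedPolyFun_of_forall_line _ f (line f hf hm) (univ_dep f)⟩

theorem degree_lt_of_mem_boundedExponents {N : ℕ} {α : Fin d →₀ ℕ}
    (hα : α ∈ boundedExponents N Finset.univ) (hd : d = 1) : α.degree < N := by
  subst hd
  simpa [Finsupp.degree_eq_sum] using (hα 0).1 (Finset.mem_univ _)

end SeveralVariables

/-! ### Distributions as functionals on jets -/

section Jets

variable {V : Type*} [NormedAddCommGroup V] [NormedSpace ℝ V]

/-- A test function regarded as a smooth function supported in a compact set `K`. -/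
noncomputable def testToSupported (K : Compacts V) (φ : 𝓓((⊤ : Opens V), ℝ)) (h : tsupport φ ⊆ K) :
    𝓓^{⊤}_{K}(V, ℝ) :=
  ContDiffMapSupportedIn.of_support_subset φ.contDiff ((subset_tsupport φ).trans h)

/-- The space of families of candidates for the derivatives of orders `i ∈ s` of a function. -/
def JetSpace (V : Type*) [NormedAddCommGroup V] [NormedSpace ℝ V] (s : Finset ℕ) : Type _ :=
  ∀ i : s, BoundedContinuousFunction V (V [×(i : ℕ)]→L[ℝ] ℝ)

namespace JetSpace

variable (s : Finset ℕ)

noncomputable instance : NormedAddCommGroup (JetSpace V s) :=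
  inferInstanceAs (NormedAddCommGroup
    (∀ i : s, BoundedContinuousFunction V (V [×(i : ℕ)]→L[ℝ] ℝ)))

noncomputable instance : NormedSpace ℝ (JetSpace V s) :=
  inferInstanceAs (NormedSpace ℝ
    (∀ i : s, BoundedContinuousFunction V (V [×(i : ℕ)]→L[ℝ] ℝ)))

instance : CompleteSpace (JetSpace V s) :=
  inferInstanceAs (CompleteSpace
    (∀ i : s, BoundedContinuousFunction V (V [×(i : ℕ)]→L[ℝ] ℝ)))

variable {s}

/-- The value of a component at a point. -/
noncomputable def eval (i : s) (y : V) : JetSpace V s →L[ℝ] (V [×(i : ℕ)]→L[ℝ] ℝ) :=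
  LinearMap.mkContinuous
    { toFun := fun f => f i y
      map_add' := fun _ _ => rfl
      map_smul' := fun _ _ => rfl } 1 (fun f => by
        rw [one_mul]
        exact ((f i).norm_coe_le_norm y).trans (norm_le_pi_norm
          (f : ∀ i : s, BoundedContinuousFunction V (V [×(i : ℕ)]→L[ℝ] ℝ)) i))

end JetSpace

/-- The derivatives of orders `i ∈ s` of a smooth function supported in `K`. -/
noncomputable def supportedJet (K : Compacts V) (s : Finset ℕ) :
    𝓓^{⊤}_{K}(V, ℝ) →ₗ[ℝ] JetSpace V s where
  toFun f i := ContDiffMapSupportedIn.structureMapLM ℝ ⊤ (i : ℕ) f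
  map_add' f g := funext fun i =>
    map_add (ContDiffMapSupportedIn.structureMapLM ℝ ⊤ (i : ℕ)) f g
  map_smul' c f := funext fun i =>
    map_smul (ContDiffMapSupportedIn.structureMapLM ℝ ⊤ (i : ℕ)) c f

/-- The derivatives of orders `i ∈ s` of a test function. -/
noncomputable def testJet (s : Finset ℕ) (φ : 𝓓((⊤ : Opens V), ℝ)) : JetSpace V s :=
  supportedJet ⟨tsupport φ, φ.hasCompactSupport⟩ s (testToSupported _ φ subset_rfl)

theorem testJet_apply (s : Finset ℕ) (φ : 𝓓((⊤ : Opens V), ℝ)) (i : s) (x : V) :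
    JetSpace.eval i x (testJet s φ) = iteratedFDeriv ℝ i φ x :=
  congr_fun (ContDiffMapSupportedIn.structureMapLM_top_apply ℝ (i := (i : ℕ))
    (testToSupported ⟨tsupport φ, φ.hasCompactSupport⟩ φ subset_rfl)) x

theorem supportedJet_testToSupported (K : Compacts V) (s : Finset ℕ) (φ : 𝓓((⊤ : Opens V), ℝ))
    (h : tsupport φ ⊆ K) : supportedJet K s (testToSupported K φ h) = testJet s φ := by
  funext i
  ext1 x
  exact (congr_fun (ContDiffMapSupportedIn.structureMapLM_top_apply ℝ (i := (i : ℕ))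
    (testToSupported K φ h)) x).trans (testJet_apply s φ i x).symm

theorem tsupport_testTranslate_subset (x : V) (φ : 𝓓((⊤ : Opens V), ℝ)) :
    tsupport (testTranslateCLM x φ) ⊆ (fun y => x + y) '' tsupport φ := by
  refine closure_minimal (fun y hy => ⟨y - x, subset_tsupport _ hy, add_sub_cancel x y⟩) ?_
  exact (φ.hasCompactSupport.isCompact.image (continuous_const.add continuous_id)).isClosed

/-- The bound makes `S` factor through the range of `J`; Hahn–Banach extends the factor to `Y`, its
target `ℂ` being finite-dimensional over `ℝ`. -/
theorem exists_continuousLinearMap_comp_eq {X Y : Type*} [AddCommGroup X] [Module ℝ X]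
    [NormedAddCommGroup Y] [NormedSpace ℝ Y] (J : X →ₗ[ℝ] Y) (S : X →ₗ[ℝ] ℂ) (C : ℝ)
    (bound : ∀ f, ‖S f‖ ≤ C * ‖J f‖) : ∃ Λ : Y →L[ℝ] ℂ, ∀ f, S f = Λ (J f) := by
  have hker : LinearMap.ker J ≤ LinearMap.ker S := by
    intro f hf
    have := bound f
    rw [LinearMap.mem_ker.1 hf, norm_zero, mul_zero] at this
    exact norm_le_zero_iff.1 this
  let g : LinearMap.range J →ₗ[ℝ] ℂ :=
    (LinearMap.ker J).liftQ S hker ∘ₗ J.quotKerEquivRange.symm.toLinearMap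
  have hg : ∀ f, g ⟨J f, f, rfl⟩ = S f := by
    intro f
    have : J.quotKerEquivRange.symm ⟨J f, f, rfl⟩ = (LinearMap.ker J).mkQ f :=
      (LinearEquiv.symm_apply_eq _).2 rfl
    simp [g, this]
  let gc : LinearMap.range J →L[ℝ] ℂ := g.mkContinuous C (by
    rintro ⟨_, f, rfl⟩
    rw [hg]
    exact bound f)
  obtain ⟨Λ, hΛ⟩ := gc.exist_extension_of_finiteDimensional_range
  refine ⟨Λ, fun f => ?_⟩
  rw [← hg]
  exact DFunLike.congr_fun hΛ (⟨J _, _, rfl⟩ : LinearMap.range J)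

/-- On test functions supported in a fixed compact set, a distribution is a continuous functional
of finitely many derivatives. -/
theorem exists_jet_functional (T : 𝓓((⊤ : Opens V), ℝ) →L[ℝ] ℂ) (K : Compacts V) :
    ∃ (s : Finset ℕ) (Λ : JetSpace V s →L[ℝ] ℂ),
      ∀ φ : 𝓓((⊤ : Opens V), ℝ), tsupport φ ⊆ K → T φ = Λ (testJet s φ) := by
  let S : 𝓓^{⊤}_{K}(V, ℝ) →L[ℝ] ℂ :=
    T ∘L TestFunction.ofSupportedInCLM ℝ (fun _ _ => trivial)
  obtain ⟨s, C, -, hC⟩ := Seminorm.bound_of_continuous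
    (ContDiffMapSupportedIn.withSeminorms ℝ V ℝ ⊤ K) ((normSeminorm ℝ ℂ).comp S.toLinearMap)
    (by exact S.continuous.norm)
  obtain ⟨Λ, hΛ⟩ := exists_continuousLinearMap_comp_eq (supportedJet K s) S.toLinearMap C
    fun f => by
      refine (hC f).trans (mul_le_mul_of_nonneg_left ?_ C.2)
      refine Seminorm.finset_sup_apply_le (norm_nonneg _) fun i hi => ?_
      rw [ContDiffMapSupportedIn.seminorm_apply]
      exact norm_le_pi_norm (fun i : s => ContDiffMapSupportedIn.structureMapCLM ℝ ⊤ (i : ℕ) f)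
        ⟨i, hi⟩
  refine ⟨s, Λ, fun φ hφ => ?_⟩
  rw [← supportedJet_testToSupported K s φ hφ, ← hΛ]
  rfl

theorem JetSpace.ext_eval {s : Finset ℕ} {f g : JetSpace V s}
    (h : ∀ i y, JetSpace.eval i y f = JetSpace.eval i y g) : f = g :=
  funext fun i => BoundedContinuousFunction.ext (h i)

theorem testJet_testTranslateCLM_apply (s : Finset ℕ) (φ : 𝓓((⊤ : Opens V), ℝ)) (i : s) (x y : V) :
    JetSpace.eval i y (testJet s (testTranslateCLM x φ)) = iteratedFDeriv ℝ i φ (y - x) := by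
  rw [testJet_apply, ← iteratedFDeriv_comp_sub]
  rfl

theorem uniformContinuous_iteratedFDeriv (φ : 𝓓((⊤ : Opens V), ℝ)) (i : ℕ) :
    UniformContinuous (iteratedFDeriv ℝ i φ) :=
  (φ.hasCompactSupport.iteratedFDeriv (𝕜 := ℝ) i).uniformContinuous_of_continuous
    (φ.contDiff.continuous_iteratedFDeriv (by exact_mod_cast le_top))

theorem JetSpace.continuous_of_forall {s : Finset ℕ} {X : Type*} [TopologicalSpace X]
    {f : X → JetSpace V s}
    (h : ∀ i : s, Continuous fun x =>
      (f x i : BoundedContinuousFunction V (V [×(i : ℕ)]→L[ℝ] ℝ))) : Continuous f :=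
  continuous_pi (A := fun i : s => BoundedContinuousFunction V (V [×(i : ℕ)]→L[ℝ] ℝ)) h

theorem continuous_testJet_translate (s : Finset ℕ) (φ : 𝓓((⊤ : Opens V), ℝ)) :
    Continuous fun x => testJet s (testTranslateCLM x φ) := by
  refine JetSpace.continuous_of_forall fun i => Metric.continuous_iff.2 fun x ε hε => ?_
  obtain ⟨δ, hδ, h⟩ :=
    Metric.uniformContinuous_iff.1 (uniformContinuous_iteratedFDeriv φ i) (ε / 2) (half_pos hε)
  refine ⟨δ, hδ, fun y hy => lt_of_le_of_lt ?_ (half_lt_self hε)⟩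
  refine (BoundedContinuousFunction.dist_le (half_pos hε).le).2 fun z => ?_
  have e := fun x => testJet_testTranslateCLM_apply s φ i x z
  have key : dist (iteratedFDeriv ℝ (i : ℕ) φ (z - y)) (iteratedFDeriv ℝ (i : ℕ) φ (z - x)) ≤
      ε / 2 := (h (by rwa [dist_sub_left])).le
  rw [← e y, ← e x] at key
  exact key

/-- For `x` near `x₀` the translates are supported in one compact set, where `T` is a continuous
functional of a jet that varies continuously with `x`. -/
theorem continuous_apply_testTranslate [FiniteDimensional ℝ V] (T : 𝓓((⊤ : Opens V), ℝ) →L[ℝ] ℂ)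
    (φ : 𝓓((⊤ : Opens V), ℝ)) : Continuous fun x => T (testTranslateCLM x φ) := by
  rw [continuous_iff_continuousAt]
  intro x₀
  obtain ⟨s, Λ, hΛ⟩ := exists_jet_functional T
    ⟨Metric.closedBall x₀ 1 + tsupport φ,
      (isCompact_closedBall x₀ 1).add φ.hasCompactSupport.isCompact⟩
  have hc := (Λ.continuous.comp (continuous_testJet_translate s φ)).continuousAt (x := x₀)
  refine hc.congr ?_
  filter_upwards [Metric.closedBall_mem_nhds x₀ one_pos] with x hx
  refine (hΛ _ ((tsupport_testTranslate_subset x φ).trans ?_)).symm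
  rintro _ ⟨y, hy, rfl⟩
  exact add_mem_add hx hy

end Jets

/-! ### Integrals of translates -/

section Convolution

open MeasureTheory ContinuousLinearMap
open scoped Convolution

variable {V : Type*} [NormedAddCommGroup V] [NormedSpace ℝ V] [MeasurableSpace V] [BorelSpace V]
  {μ : Measure V}

theorem map_integral_smul {X : Type*} [MeasurableSpace X] {μ : Measure X} {F G : Type*}
    [NormedAddCommGroup F] [NormedSpace ℝ F] [NormedAddCommGroup G] [NormedSpace ℝ G]
    (L : F ≃ₗᵢ[ℝ] G) (f : X → ℝ) (g : X → F) :
    L (∫ t, f t • g t ∂μ) = ∫ t, f t • L (g t) ∂μ := by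
  simp_rw [← map_smul]
  exact (L.toContinuousLinearEquiv.integral_comp_comm _).symm

theorem iteratedFDeriv_convolution_right [SFinite μ] [μ.IsAddLeftInvariant]
    {F : Type*} [NormedAddCommGroup F] [NormedSpace ℝ F]
    {f : V → ℝ} {g : V → F} (hf : LocallyIntegrable f μ)
    (hcg : HasCompactSupport g) (hg : ContDiff ℝ ∞ g) (i : ℕ) :
    iteratedFDeriv ℝ i (f ⋆[lsmul ℝ ℝ, μ] g) = f ⋆[lsmul ℝ ℝ, μ] iteratedFDeriv ℝ i g := by
  induction i with
  | zero =>
    ext1 x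
    rw [iteratedFDeriv_zero_eq_comp, iteratedFDeriv_zero_eq_comp, Function.comp_apply,
      convolution_def, convolution_def]
    exact map_integral_smul (continuousMultilinearCurryFin0 ℝ V F).symm f _
  | succ i ih =>
    ext1 x
    rw [iteratedFDeriv_succ_eq_comp_left, iteratedFDeriv_succ_eq_comp_left, Function.comp_apply, ih,
      ((hcg.iteratedFDeriv (𝕜 := ℝ) i).hasFDerivAt_convolution_right (lsmul ℝ ℝ) hf
        (hg.iteratedFDeriv_right (m := 1) (i := i) (by exact_mod_cast le_top)) x).fderiv,
      convolution_def, convolution_def]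
    exact map_integral_smul
      (continuousMultilinearCurryLeftEquiv ℝ (fun _ : Fin (i + 1) => V) F).symm f
      fun t => fderiv ℝ (iteratedFDeriv ℝ i g) (x - t)

theorem integrable_smul_testJet_translate [IsFiniteMeasureOnCompacts μ] (s : Finset ℕ)
    (φ ψ : 𝓓((⊤ : Opens V), ℝ)) :
    Integrable (fun x => ψ x • testJet s (testTranslateCLM x φ)) μ :=
  (ψ.continuous.smul (continuous_testJet_translate s φ)).integrable_of_hasCompactSupport
    ψ.hasCompactSupport.smul_right

variable [FiniteDimensional ℝ V] [μ.IsAddHaarMeasure]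

theorem eval_integral_smul_testJet_translate (s : Finset ℕ) (φ ψ : 𝓓((⊤ : Opens V), ℝ)) (i : s)
    (y : V) : JetSpace.eval i y (∫ x, ψ x • testJet s (testTranslateCLM x φ) ∂μ) =
      iteratedFDeriv ℝ i (ψ ⋆[lsmul ℝ ℝ, μ] φ) y := by
  rw [iteratedFDeriv_convolution_right ψ.continuous.locallyIntegrable φ.hasCompactSupport
    φ.contDiff, convolution_def,
    ← (JetSpace.eval i y).integral_comp_comm (integrable_smul_testJet_translate s φ ψ)]
  congr 1
  ext1 x
  rw [map_smul, testJet_testTranslateCLM_apply]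
  rfl

/-- Both sides are the jet of a convolution, and convolution is commutative. -/
theorem integral_smul_testJet_translate_comm (s : Finset ℕ) (φ ψ : 𝓓((⊤ : Opens V), ℝ)) :
    ∫ x, ψ x • testJet s (testTranslateCLM x φ) ∂μ =
      ∫ x, φ x • testJet s (testTranslateCLM x ψ) ∂μ := by
  refine JetSpace.ext_eval fun i y => ?_
  rw [eval_integral_smul_testJet_translate, eval_integral_smul_testJet_translate,
    ← convolution_flip]
  congr 2
  ext
  simp

/-- This moves the mollifier across `T`. Factoring `T` through jets puts the integral in a Banach
space, where it commutes with the functional. -/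
theorem integral_smul_apply_testTranslate_comm (T : 𝓓((⊤ : Opens V), ℝ) →L[ℝ] ℂ)
    (φ ψ : 𝓓((⊤ : Opens V), ℝ)) :
    ∫ x, ψ x • T (testTranslateCLM x φ) ∂μ = ∫ x, φ x • T (testTranslateCLM x ψ) ∂μ := by
  obtain ⟨s, Λ, hΛ⟩ := exists_jet_functional T
    ⟨tsupport φ + tsupport ψ, φ.hasCompactSupport.isCompact.add ψ.hasCompactSupport.isCompact⟩
  have e : ∀ φ' ψ' : 𝓓((⊤ : Opens V), ℝ), tsupport ψ' + tsupport φ' ⊆ tsupport φ + tsupport ψ →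
      ∫ x, ψ' x • T (testTranslateCLM x φ') ∂μ =
        Λ (∫ x, ψ' x • testJet s (testTranslateCLM x φ') ∂μ) := by
    intro φ' ψ' h
    rw [← Λ.integral_comp_comm (integrable_smul_testJet_translate s φ' ψ')]
    congr 1
    ext1 x
    rw [map_smul]
    by_cases hx : ψ' x = 0
    · simp [hx]
    · rw [hΛ]
      refine (tsupport_testTranslate_subset x φ').trans ?_
      rintro _ ⟨y, hy, rfl⟩
      exact h (add_mem_add (subset_tsupport _ hx) hy)
  rw [e φ ψ (by rw [add_comm]), e ψ φ subset_rfl, integral_smul_testJet_translate_comm]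

end Convolution

/-! ### Distributions with vanishing iterated differences -/

section Distributions

open MeasureTheory Filter
open scoped Convolution

/-- Translations commute, so a difference in the parameter `x` is a difference of `T`. -/
theorem fwdDiff_iterate_apply_testTranslate {V : Type*} [NormedAddCommGroup V] [NormedSpace ℝ V]
    (h : V) (φ : 𝓓((⊤ : Opens V), ℝ)) (m : ℕ) (T : 𝓓'((⊤ : Opens V), ℂ)) :
    (fwdDiff h)^[m] (fun x => T (testTranslateCLM x φ)) =
      fun x => (distFwdDiff h)^[m] T (testTranslateCLM x φ) := by
  induction m generalizing T with
  | zero => rfl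
  | succ m ih =>
    rw [Function.iterate_succ_apply, Function.iterate_succ_apply, ← ih]
    congr 1
    ext x
    rw [distFwdDiff_apply, fwdDiff]
    congr 2
    ext y
    simp only [testTranslateCLM_apply]
    congr 1
    abel

/-- The normalized bump function `ρ` as a test function. -/
noncomputable def normedBump {V : Type*} [NormedAddCommGroup V] [NormedSpace ℝ V]
    [HasContDiffBump V] [FiniteDimensional ℝ V] [MeasurableSpace V] [BorelSpace V] (μ : Measure V)
    [μ.IsAddHaarMeasure] (ρ : ContDiffBump (0 : V)) : 𝓓((⊤ : Opens V), ℝ) where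
  toFun := ρ.normed μ
  contDiff' := ρ.contDiff_normed
  hasCompactSupport' := ρ.hasCompactSupport_normed
  tsupport_subset' := fun _ _ => trivial

variable {d : ℕ}

theorem continuous_polyFun (p : MvPolynomial (Fin d) ℂ) : Continuous (polyFun p) := by
  unfold polyFun
  have := MvPolynomial.continuous_eval p
  fun_prop

theorem integrable_smul_polyFun (φ : 𝓓((⊤ : Opens (EuclideanSpace ℝ (Fin d))), ℝ))
    (p : MvPolynomial (Fin d) ℂ) : Integrable fun x => φ x • polyFun p x :=
  (φ.continuous.smul (continuous_polyFun p)).integrable_of_hasCompactSupport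
    φ.hasCompactSupport.smul_right

/-- The map that takes a polynomial to the functional of integration against it. -/
noncomputable def polyFunctional (d : ℕ) : MvPolynomial (Fin d) ℂ →ₗ[ℂ]
    (𝓓((⊤ : Opens (EuclideanSpace ℝ (Fin d))), ℝ) → ℂ) where
  toFun p φ := ∫ x, φ x • polyFun p x
  map_add' p q := by
    ext φ
    rw [Pi.add_apply, ← integral_add (integrable_smul_polyFun φ p) (integrable_smul_polyFun φ q)]
    simp [polyFun]
  map_smul' c p := by
    ext φ
    rw [Pi.smul_apply, RingHom.id_apply, ← integral_smul]
    simp [polyFun, mul_left_comm]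

theorem mem_map_polyFunctional_of_forall_mem_boundedPolyFun {N : ℕ}
    (T : 𝓓((⊤ : Opens (EuclideanSpace ℝ (Fin d))), ℝ) →L[ℝ] ℂ)
    (hT : ∀ φ, (fun x => T (testTranslateCLM x φ)) ∈ boundedPolyFun N Finset.univ) :
    (T : _ → ℂ) ∈ (MvPolynomial.restrictSupport ℂ
      (boundedExponents (d := d) N Finset.univ)).map (polyFunctional d) := by
  have : FiniteDimensional ℂ
      (MvPolynomial.restrictSupport ℂ (boundedExponents (d := d) N Finset.univ)) := by
    have := (finite_boundedExponents (d := d) N Finset.univ).to_subtype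
    exact Module.Finite.of_basis (MvPolynomial.basisRestrictSupport ℂ _)
  let ρ : ℕ → ContDiffBump (0 : EuclideanSpace ℝ (Fin d)) := fun n =>
    { rIn := 1 / (n + 1) / 2
      rOut := 1 / (n + 1)
      rIn_pos := by positivity
      rIn_lt_rOut := half_lt_self (by positivity) }
  refine (Submodule.closed_of_finiteDimensional _).mem_of_tendsto (b := atTop)
    (f := fun n φ => ∫ x, φ x • T (testTranslateCLM x (normedBump volume (ρ n)))) ?_ ?_
  · rw [tendsto_pi_nhds]
    intro φ
    -- The sign cancels the reflection in the convolution at `0`, which becomes the integral of the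
    -- mollifier at `t` times `T(φ(· - t))`.
    have hc : Continuous fun x => T (testTranslateCLM (-x) φ) :=
      (continuous_apply_testTranslate T φ).comp continuous_neg
    have lim := ContDiffBump.convolution_tendsto_right_of_continuous (φ := ρ) (l := atTop)
      (μ := volume) tendsto_one_div_add_atTop_nhds_zero_nat hc 0
    have h0 : testTranslateCLM (-0) φ = φ := by
      ext y
      simp [testTranslateCLM_apply]
    rw [h0] at lim
    refine lim.congr fun n => ?_
    rw [integral_smul_apply_testTranslate_comm T _ φ, convolution_lsmul]
    simp only [zero_sub, neg_neg]
    rfl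
  · refine Eventually.of_forall fun n => ?_
    obtain ⟨p, hp, hpT⟩ := hT (normedBump volume (ρ n))
    refine ⟨p, hp, funext fun φ => ?_⟩
    have hpT' : ∀ x, polyFun p x = T (testTranslateCLM x (normedBump volume (ρ n))) :=
      congr_fun hpT
    simp only [← hpT']
    rfl

end Distributions

theorem theorem2p10 (d ℓ m : ℕ) (h : Fin ℓ → EuclideanSpace ℝ (Fin d))
    (hdense : Dense
      (AddSubgroup.closure (Set.range h) : Set (EuclideanSpace ℝ (Fin d)))) :
    (∀ f : EuclideanSpace ℝ (Fin d) → ℂ, Continuous f →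
      (∀ k, (fwdDiff (h k))^[m] f = 0) →
      ∃ p : MvPolynomial (Fin d) ℂ,
        (∀ x, f x = polyFun p x) ∧ (d = 1 → ∀ α ∈ p.support, α.degree < m)) ∧
    (∀ T : Distribution (⊤ : TopologicalSpace.Opens (EuclideanSpace ℝ (Fin d))) ℂ ⊤,
      (∀ k, (distFwdDiff (h k))^[m] T = 0) →
      ∃ p : MvPolynomial (Fin d) ℂ,
        (∀ φ : TestFunction (⊤ : TopologicalSpace.Opens (EuclideanSpace ℝ (Fin d))) ℝ ⊤,
          T φ = ∫ x, (φ x : ℂ) * polyFun p x) ∧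
        (d = 1 → ∀ α ∈ p.support, α.degree < m)) := by
  -- One `N` serves `f` and all functions `x ↦ T(φ(· - x))`.
  obtain ⟨N, hN, key⟩ := exists_forall_mem_boundedPolyFun m h hdense
  refine ⟨fun f hf hm => ?_, fun T hT => ?_⟩
  · obtain ⟨p, hp, hpf⟩ := key f hf hm
    exact ⟨p, fun x => (congr_fun hpf x).symm, fun hd α hα =>
      hN hd ▸ degree_lt_of_mem_boundedExponents (hp hα) hd⟩
  · obtain ⟨p, hp, hpT⟩ := mem_map_polyFunctional_of_forall_mem_boundedPolyFun (N := N) T fun φ =>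
      key _ (continuous_apply_testTranslate T φ) fun k => by
        refine (fwdDiff_iterate_apply_testTranslate (h k) φ m T).trans ?_
        rw [hT k]
        rfl
    refine ⟨p, fun φ => ?_, fun hd α hα =>
      hN hd ▸ degree_lt_of_mem_boundedExponents (hp hα) hd⟩
    refine (congr_fun hpT φ).symm.trans ?_
    simp only [← Complex.real_smul]
    rfl
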